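/- For a finitely generated group $G$, let $S(G)=(\mathrm{Hom}(G,\mathbb R)\setminus\{0\})/\mathbb R_{>0}$ be its character sphere, with classes $[\chi]$. If $x_1,\dots,x_k\in G$ map to a basis of the abelianization of $G$ modulo torsion, $S(G)$ is identified with the unit sphere of $\mathbb R^k$ by $[\chi]\mapsto (\chi(x_1),\dots,\chi(x_k))/\|(\chi(x_1),\dots,\chi(x_k))\|$, and an open hemisphere of $S(G)$ is a set corresponding to $\{p : \langle p,v\rangle>0\}$ for a unit vector $v$. For a finite generating set $X$ of $G$, the Bieri–Neumann–Strebel invariant $\Sigma^1(G)\subseteq S(G)$ is the set of all $[\chi]$ such that the subgraph of the Cayley graph of $G$ with respect to $X$ (with edges joining $g$ and $gx$, $x\in X$) spanned by the vertices $g$ with $\chi(g)\ge 0$ is connected; $\Sigma^1(G)^c$ is its complement in $S(G)$. Let $n_1,\dots,n_r$ be pairwise coprime positive integers with $n_i\ge 2$ for at least one $i$, and let $$\Gamma(S)=\langle a,t_1,\dots,t_r \mid t_it_j=t_jt_i\ (i\ne j),\ t_iat_i^{-1}=a^{n_i}\ (1\le i\le r)\rangle .$$ For each $i$ there is exactly one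 character $\chi_i:\Gamma(S)\to\mathbb R$ with $\chi_i(t_i)=1$ and $\chi_i(t_j)=0$ for $j\ne i$; the classes $[\chi_1],\dots,[\chi_r]$ are pairwise distinct, and, whichever finite generating set of $\Gamma(S)$ is used, $$\Sigma^1(\Gamma(S))^c=\{[\chi_i] \mid 1\le i\le r,\ n_i\ge 2\}.$$ So if all $n_i\ge 2$, then $\Sigma^1(\Gamma(S))^c=\{[\chi_1],\dots,[\chi_r]\}$. Moreover $\Sigma^1(\Gamma(S))^c$ lies in an open hemisphere of $S(\Gamma(S))$. In particular, let $n\ge 2$ have the prime decomposition $n=p_1^{y_1}\cdots p_r^{y_r}$ and let $\Gamma_n$ be the group $\Gamma(S)$ for $n_i=p_i^{y_i}$. Then $\Sigma^1(\Gamma_n)^c=\{[\chi_1],\dots,[\chi_r]\}$, and this set lies in an open hemisphere of $S(\Gamma_n)$. -/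

import Mathlib

noncomputable section

/-- The real vector space `Hom(G, ℝ)` of (additive) characters of a group `G`. -/
abbrev RealChar (G : Type*) [Group G] : Type _ := Additive G →+ ℝ

/-- The value `χ(g)`. -/
abbrev RealChar.val {G : Type*} [Group G] (χ : RealChar G) (g : G) : ℝ := χ (Additive.ofMul g)

/-- The character sphere `S(G)`: nonzero characters modulo multiplication by positive reals. -/
abbrev CharSphere (G : Type*) [Group G] : Type _ := Module.Ray ℝ (RealChar G)

/-- The class `[χ]` of a nonzero character. -/
abbrev charClass {G : Type*} [Group G] (χ : RealChar G) (hχ : χ ≠ 0) : CharSphere G :=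
  rayOfNeZero ℝ χ hχ

/-- Two nonzero characters have the same class iff one is a positive multiple of the other. -/
theorem charClass_eq_iff {G : Type*} [Group G] (χ ψ : RealChar G) (hχ : χ ≠ 0) (hψ : ψ ≠ 0) :
    charClass χ hχ = charClass ψ hψ ↔ ∃ r : ℝ, 0 < r ∧ r • χ = ψ := by
  rw [charClass, charClass, ray_eq_iff]
  constructor
  · intro h
    exact h.exists_pos_left hχ hψ
  · rintro ⟨r, hr, rfl⟩
    exact SameRay.sameRay_pos_smul_right χ hr

/-- The subgraph `Γ_χ` of the Cayley graph of `G` with respect to `X` (edges `g — g x`, `x ∈ X`)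
spanned by the vertices `g` with `χ(g) ≥ 0`. -/
def cayleyHalf {G : Type*} [Group G] (X : Set G) (χ : RealChar G) :
    SimpleGraph {g : G | 0 ≤ χ.val g} :=
  (SimpleGraph.mulCayley X).induce {g : G | 0 ≤ χ.val g}

/-- The Bieri-Neumann-Strebel invariant `Σ¹(G)`, computed with the finite generating set `X`. -/
def Sigma1 {G : Type*} [Group G] (X : Set G) : Set (CharSphere G) :=
  {s | ∃ (χ : RealChar G) (hχ : χ ≠ 0), s = charClass χ hχ ∧ (cayleyHalf X χ).Connected}

/-- `x₁, …, x_k ∈ G` are free-abelian generators of the abelianization of `G`: their images form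
a `ℤ`-basis of the abelianization modulo its torsion. -/
def IsFreeAbGenerators {G : Type*} [Group G] {k : ℕ} (x : Fin k → G) : Prop :=
  ∃ b : Module.Basis (Fin k) ℤ
      (Additive (Abelianization G) ⧸ Submodule.torsion ℤ (Additive (Abelianization G))),
    ∀ i, b i = Submodule.Quotient.mk (Additive.ofMul (Abelianization.of (x i)))

/-- The vector `(χ(x₁), …, χ(x_k))`. -/
def charVector {G : Type*} [Group G] {k : ℕ} (x : Fin k → G) (χ : RealChar G) :
    EuclideanSpace ℝ (Fin k) :=
  WithLp.toLp 2 fun i => χ.val (x i)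

theorem charVector_smul {G : Type*} [Group G] {k : ℕ} (x : Fin k → G) (r : ℝ) (χ : RealChar G) :
    charVector x (r • χ) = r • charVector x χ := by
  ext i
  simp [charVector]

/-- The map `S(G) → ℝ^k`, `[χ] ↦ (χ(x₁), …, χ(x_k)) / ‖(χ(x₁), …, χ(x_k))‖`; it identifies `S(G)`
with the unit sphere if `x₁, …, x_k` are free-abelian generators. -/
def sphereMap {G : Type*} [Group G] {k : ℕ} (x : Fin k → G) (s : CharSphere G) :
    EuclideanSpace ℝ (Fin k) :=
  Quotient.lift
    (fun χ : RayVector ℝ (RealChar G) =>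
      ‖charVector x (χ : RealChar G)‖⁻¹ • charVector x (χ : RealChar G))
    (by
      intro χ ψ h
      obtain ⟨r, hr, hrψ⟩ :=
        (show SameRay ℝ (χ : RealChar G) (ψ : RealChar G) from h).exists_pos_left χ.2 ψ.2
      simp only [← hrψ, charVector_smul, norm_smul, Real.norm_eq_abs, abs_of_pos hr, mul_inv,
        smul_smul]
      congr 1
      field_simp) s

/-- Open hemispheres of `S(G)`: the sets that correspond to `{p ∈ S^{k-1} | ⟨p, v⟩ > 0}` with
`v ∈ S^{k-1}` under the identification of `S(G)` with the unit sphere of `ℝ^k`. -/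
def IsOpenHemisphere {G : Type*} [Group G] (U : Set (CharSphere G)) : Prop :=
  ∃ (k : ℕ) (x : Fin k → G) (v : EuclideanSpace ℝ (Fin k)),
    IsFreeAbGenerators x ∧ ‖v‖ = 1 ∧ U = {s | 0 < inner ℝ (sphereMap x s) v}

/-- The letters `a` and `t_i`. -/
inductive BSGen (ι : Type*) : Type _
  | a : BSGen ι
  | t (i : ι) : BSGen ι

/-- The relators `t_i t_j t_i⁻¹ t_j⁻¹` for `i ≠ j` and `t_i a t_i⁻¹ a^{-n_i}`. -/
def bsRels {ι : Type*} (n : ι → ℕ) : Set (FreeGroup (BSGen ι)) :=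
  {w | ∃ i j, i ≠ j ∧ w = .of (.t i) * .of (.t j) * (.of (.t i))⁻¹ * (.of (.t j))⁻¹} ∪
  {w | ∃ i, w = .of (.t i) * .of .a * (.of (.t i))⁻¹ * (.of .a ^ n i)⁻¹}

/-- The group `Γ(S)`, for the family `S = (n_i)`. -/
abbrev GammaS {ι : Type*} (n : ι → ℕ) : Type _ := PresentedGroup (bsRels n)

/-- The element `t_i` of `Γ(S)`. -/
abbrev GammaS.t {ι : Type*} (n : ι → ℕ) (i : ι) : GammaS n := PresentedGroup.of (.t i)

/-- The prime powers `p^y` exactly dividing `N`, indexed by the prime factors `p` of `N`. -/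
def primePowers (N : ℕ) (p : N.primeFactors) : ℕ := (p : ℕ) ^ N.factorization p

/-- The group `Γ_N`. -/
abbrev GammaN (N : ℕ) : Type := GammaS (primePowers N)

open Classical in
/-- The character `χ_i` of `Γ(S)`: `a ↦ 0`, `t_i ↦ 1`, and `t_j ↦ 0` for `j ≠ i`. -/
def chi {ι : Type*} (n : ι → ℕ) (i : ι) : RealChar (GammaS n) :=
  MonoidHom.toAdditiveLeft (PresentedGroup.toGroup (rels := bsRels n)
    (f := fun g : BSGen ι => match g with
      | .a => Multiplicative.ofAdd (0 : ℝ)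
      | .t j => Multiplicative.ofAdd (if j = i then (1 : ℝ) else 0))
    (by
      rintro w (⟨j, k, -, rfl⟩ | ⟨j, rfl⟩)
      · simp only [map_mul, map_inv, FreeGroup.lift_apply_of]
        rw [mul_inv_eq_one, mul_inv_eq_iff_eq_mul, mul_comm]
      · simp))

theorem chi_t_self {ι : Type*} (n : ι → ℕ) (i : ι) : (chi n i).val (GammaS.t n i) = 1 := by
  simp [chi, RealChar.val, GammaS.t]

theorem chi_ne_zero {ι : Type*} (n : ι → ℕ) (i : ι) : chi n i ≠ 0 := by
  intro h
  have := chi_t_self n i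
  rw [h] at this
  simp [RealChar.val] at this

end

/-!
Write `Γ = Γ(S)`, let `T` be the abelian subgroup generated by the `t_i`, and let `A` be the
subgroup generated by the conjugates `τ a τ⁻¹` with `τ ∈ T`, so that `Γ = A T`. Since some
`n_i ≥ 2`, the element `a` is torsion in the abelianization, so a real character `χ` is determined
by the values `χ(t_i)`, and the `t_i` are free-abelian generators. The hemisphere about
`(1, …, 1)` then contains all the `[χ_i]`.

*Characters in `Σ¹`* (`GammaS.mem_of_half_space`, `GammaS.eq_smul_chi_or_connected`). Suppose that
`χ ≠ 0` is not a positive multiple of a `χ_i` with `n_i ≥ 2`. Then some `χ(t_j)` is negative, or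
`χ(t_i) > 0` for some `i` with `n_i = 1`, or `χ(t_i), χ(t_j) > 0` for two indices. The elements that
can be joined to `1` inside the half space `χ ≥ 0` contain the part of `T` in the half space, and
those of height `0` form a group `H`, stable under conjugation by that part of `T`. For
`x = τ a τ⁻¹` one has `t_i^K x t_i^{-K} = x^{n_i^K}`, so that `H` contains a root of `x`, or `x`
itself, or two powers of `x` with coprime exponents; hence `A ≤ H`, and the half space is connected.
To treat every finite generating set at once, the argument is run with paths that may descend to
some fixed depth `d`, chosen so that the `a` and `t_i^{±1}` can be reached; this is enough by
`cayleyHalf_connected_of_bounded_depth`.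

*Characters outside `Σ¹`* (`GammaS.not_cayleyHalf_connected`). If `n_i ≥ 2`, choose a prime
`p ∣ n_i` and let `Γ` act on `ℚ_p` by `a : x ↦ x + 1` and `t_j : x ↦ n_j x`. By coprimality `g`
scales `p`-adic distances by `|n_i|_p ^ χ_i(g)`, so inside the half space `χ_i ≥ 0` every edge moves
the orbit point `g • 0` by a bounded distance, and by the ultrametric inequality the whole component
of `1` keeps it in a ball. But `t_i^{-m} a t_i^m`, of height `0`, moves `0` to `n_i^{-m}`.
-/

noncomputable section

/-! ### Values of real characters -/

namespace RealChar

variable {G : Type*} [Group G] (χ : RealChar G)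

theorem val_one : χ.val 1 = 0 := map_zero χ

theorem val_mul (g h : G) : χ.val (g * h) = χ.val g + χ.val h := map_add χ _ _

theorem val_inv (g : G) : χ.val g⁻¹ = -χ.val g := map_neg χ _

theorem val_pow (g : G) (m : ℕ) : χ.val (g ^ m) = m * χ.val g := by
  rw [← nsmul_eq_mul]
  exact map_nsmul χ m _

theorem val_smul (r : ℝ) (g : G) : (r • χ).val g = r * χ.val g := rfl

theorem val_conj (g h : G) : χ.val (g * h * g⁻¹) = χ.val h := by
  rw [val_mul, val_mul, val_inv]; ring

variable {χ} in
theorem ext_of_closure {ψ : RealChar G} {S : Set G} (hS : Subgroup.closure S = ⊤)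
    (h : ∀ g ∈ S, χ.val g = ψ.val g) : χ = ψ := by
  have key : AddMonoidHom.toMultiplicativeRight χ = AddMonoidHom.toMultiplicativeRight ψ :=
    MonoidHom.eq_of_eqOn_dense hS fun g hg => congrArg Multiplicative.ofAdd (h g hg)
  exact AddMonoidHom.toMultiplicativeRight.injective key

end RealChar

/-! ### Paths above a given height in a Cayley graph -/

/-- `HalfReach X χ d g h`: there is a path from `g` to `h` in the Cayley graph of `G` with respect
to `X`, all of whose edges join vertices of `χ`-height at least `d`. The path of length zero from
`g` to `g` is allowed whatever the height of `g`. -/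
def HalfReach {G : Type*} [Group G] (X : Set G) (χ : RealChar G) (d : ℝ) : G → G → Prop :=
  Relation.ReflTransGen fun g h =>
    d ≤ χ.val g ∧ d ≤ χ.val h ∧ ∃ x ∈ X, g * x = h ∨ g = h * x

namespace HalfReach

variable {G : Type*} [Group G] {X : Set G} {χ : RealChar G} {d e : ℝ} {g h k : G}

theorem trans (h₁ : HalfReach X χ d g h) (h₂ : HalfReach X χ d h k) : HalfReach X χ d g k :=
  Relation.ReflTransGen.trans h₁ h₂

theorem symm (h₁ : HalfReach X χ d g h) : HalfReach X χ d h g := by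
  refine Relation.ReflTransGen.swap _ _ (Relation.ReflTransGen.mono ?_ _ _ h₁)
  rintro g h ⟨hg, hh, x, hx, hgh⟩
  exact ⟨hh, hg, x, hx, hgh.symm.imp Eq.symm Eq.symm⟩

theorem mono (hde : d ≤ e) (h₁ : HalfReach X χ e g h) : HalfReach X χ d g h :=
  Relation.ReflTransGen.mono (fun _ _ ⟨a, b, c⟩ => ⟨hde.trans a, hde.trans b, c⟩) _ _ h₁

/-- Left translation by `k` is an automorphism of the Cayley graph that raises heights by
`χ(k)`. -/
theorem translate (k : G) (h₁ : HalfReach X χ d g h) :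
    HalfReach X χ (χ.val k + d) (k * g) (k * h) := by
  refine Relation.ReflTransGen.lift (k * ·) ?_ _ _ h₁
  rintro g h ⟨hg, hh, x, hx, hgh⟩
  refine ⟨by rw [RealChar.val_mul]; linarith, by rw [RealChar.val_mul]; linarith, x, hx, ?_⟩
  rcases hgh with rfl | rfl
  · exact Or.inl (mul_assoc _ _ _)
  · exact Or.inr (mul_assoc _ _ _).symm

theorem mul_right (hg : e ≤ χ.val g + d) (h₁ : HalfReach X χ d 1 h) :
    HalfReach X χ e g (g * h) := by
  simpa using (h₁.translate g).mono hg

theorem exists_of_closure (hX : Subgroup.closure X = ⊤) (χ : RealChar G) (g : G) :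
    ∃ d, HalfReach X χ d 1 g := by
  have hg : g ∈ Subgroup.closure X := hX ▸ Subgroup.mem_top g
  induction hg using Subgroup.closure_induction with
  | mem x hx =>
    refine ⟨min 0 (χ.val x), Relation.ReflTransGen.single ⟨?_, min_le_right _ _, x, hx, ?_⟩⟩
    · rw [RealChar.val_one]; exact min_le_left _ _
    · simp
  | one => exact ⟨0, Relation.ReflTransGen.refl⟩
  | mul x y _ _ hx hy =>
    obtain ⟨d, hd⟩ := hx
    obtain ⟨e, he⟩ := hy
    exact ⟨min d (χ.val x + e), (hd.mono (min_le_left _ _)).trans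
      (he.mul_right (min_le_right _ _))⟩
  | inv x _ hx =>
    obtain ⟨d, hd⟩ := hx
    exact ⟨χ.val x⁻¹ + d, by simpa using (hd.translate x⁻¹).symm⟩

theorem exists_forall_of_finite (hX : Subgroup.closure X = ⊤) (χ : RealChar G) {F : Set G}
    (hF : F.Finite) : ∃ d, ∀ g ∈ F, HalfReach X χ d 1 g := by
  choose f hf using exists_of_closure hX χ
  obtain ⟨b, hb⟩ := (hF.image f).bddBelow
  exact ⟨b, fun g hg => (hf g).mono (hb ⟨g, hg, rfl⟩)⟩

/-- A path of nonnegative height is a path in `cayleyHalf`. -/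
theorem reachable (hg : 0 ≤ χ.val g) (h₁ : HalfReach X χ 0 g h) :
    ∃ hh : 0 ≤ χ.val h, (cayleyHalf X χ).Reachable ⟨g, hg⟩ ⟨h, hh⟩ := by
  induction h₁ with
  | refl => exact ⟨hg, SimpleGraph.Reachable.refl _⟩
  | @tail b c _ hstep ih =>
    obtain ⟨hb, hreach⟩ := ih
    obtain ⟨_, hc, x, hx, hbc⟩ := hstep
    refine ⟨hc, hreach.trans ?_⟩
    by_cases hne : b = c
    · subst hne; exact SimpleGraph.Reachable.refl _
    · refine SimpleGraph.Adj.reachable ?_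
      rw [cayleyHalf, SimpleGraph.induce, SimpleGraph.comap_adj]
      exact (SimpleGraph.mulCayley_adj' X b c).2 ⟨hne, x, hx, hbc⟩

end HalfReach

/-- If every point of the half space can be joined to `1` within bounded depth, the half space is
connected: push such a path up by left translation with a high power of a generator `y` with
`χ(y) ≠ 0`, and join its ends to the original points by powers of `y`. -/
theorem cayleyHalf_connected_of_bounded_depth {G : Type*} [Group G] {X : Set G}
    (hX : Subgroup.closure X = ⊤) {χ : RealChar G} (hχ : χ ≠ 0) {d : ℝ}
    (h : ∀ g, 0 ≤ χ.val g → HalfReach X χ d 1 g) : (cayleyHalf X χ).Connected := by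
  -- an element `y` with `χ(y) > 0` that is a generator or the inverse of one
  obtain ⟨y, hy, hy1⟩ : ∃ y, 0 < χ.val y ∧ HalfReach X χ 0 1 y := by
    obtain ⟨x, hx, hx0⟩ : ∃ x ∈ X, χ.val x ≠ 0 := by
      by_contra! hcon
      exact hχ (RealChar.ext_of_closure hX fun g hg => hcon g hg)
    rcases lt_or_gt_of_ne hx0 with hneg | hpos
    · refine ⟨x⁻¹, by rw [RealChar.val_inv]; linarith, Relation.ReflTransGen.single
        ⟨(RealChar.val_one χ).ge, by rw [RealChar.val_inv]; linarith, x, hx, by simp⟩⟩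
    · exact ⟨x, hpos, Relation.ReflTransGen.single
        ⟨(RealChar.val_one χ).ge, hpos.le, x, hx, by simp⟩⟩
  have hpow : ∀ m : ℕ, HalfReach X χ 0 1 (y ^ m) := by
    intro m
    induction m with
    | zero => rw [pow_zero]; exact Relation.ReflTransGen.refl
    | succ m ih =>
      rw [pow_succ]
      refine ih.trans (hy1.mul_right ?_)
      rw [RealChar.val_pow]
      positivity
  obtain ⟨m, hm⟩ := exists_nat_ge (-d / χ.val y)
  rw [div_le_iff₀ hy] at hm
  have hreach : ∀ g, 0 ≤ χ.val g → HalfReach X χ 0 1 g := by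
    intro g hg
    have h₁ : HalfReach X χ 0 (y ^ m) (y ^ m * ((y ^ m)⁻¹ * g * y ^ m)) := by
      refine (h _ ?_).mul_right ?_
      · rw [RealChar.val_mul, RealChar.val_mul, RealChar.val_inv]; linarith
      · rw [RealChar.val_pow]; linarith
    have h₂ : HalfReach X χ 0 g (g * y ^ m) := (hpow m).mul_right (by linarith)
    have h₃ : y ^ m * ((y ^ m)⁻¹ * g * y ^ m) = g * y ^ m := by group
    rw [h₃] at h₁
    exact ((hpow m).trans h₁).trans h₂.symm
  have h1 : 0 ≤ χ.val 1 := (RealChar.val_one χ).ge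
  refine (SimpleGraph.connected_iff_exists_forall_reachable _).2 ⟨⟨1, h1⟩, ?_⟩
  rintro ⟨g, hg⟩
  exact ((hreach g hg).reachable h1).2

/-- The submonoid of those elements `g` with `χ(g) ≥ 0` that can be joined to `1`
above height `d`. -/
def reachSubmonoid {G : Type*} [Group G] (X : Set G) (χ : RealChar G) (d : ℝ) :
    Submonoid G where
  carrier := {g | 0 ≤ χ.val g ∧ HalfReach X χ d 1 g}
  one_mem' := ⟨(RealChar.val_one χ).ge, Relation.ReflTransGen.refl⟩
  mul_mem' := by
    rintro g h ⟨hg, hg'⟩ ⟨hh, hh'⟩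
    exact ⟨by rw [RealChar.val_mul]; exact add_nonneg hg hh,
      hg'.trans (hh'.mul_right (by linarith))⟩

theorem reachSubmonoid_of_mul_mem {G : Type*} [Group G] {X : Set G} {χ : RealChar G} {d : ℝ}
    {g q : G} (hg : 0 ≤ χ.val g) (hq : q ∈ reachSubmonoid X χ d)
    (hgq : g * q ∈ reachSubmonoid X χ d) : g ∈ reachSubmonoid X χ d :=
  ⟨hg, hgq.2.trans (hq.2.mul_right (by linarith)).symm⟩

/-! ### Generators, relations and characters of `Γ(S)` -/

namespace GammaS

variable {ι : Type*} {n : ι → ℕ}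

/-- The element `a` of `Γ(S)`. -/
abbrev a (n : ι → ℕ) : GammaS n := PresentedGroup.of .a

theorem t_commute (i j : ι) : t n i * t n j = t n j * t n i := by
  by_cases hij : i = j
  · rw [hij]
  · have h : (PresentedGroup.mk (bsRels n) (.of (.t i) * .of (.t j) * (.of (.t i))⁻¹ *
        (.of (.t j))⁻¹)) = 1 := PresentedGroup.one_of_mem (Or.inl ⟨i, j, hij, rfl⟩)
    simp only [map_mul, map_inv] at h
    exact mul_inv_eq_iff_eq_mul.1 (mul_inv_eq_one.1 h)

theorem t_conj_a (i : ι) : t n i * a n * (t n i)⁻¹ = a n ^ n i := by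
  have h : (PresentedGroup.mk (bsRels n) (.of (.t i) * .of .a * (.of (.t i))⁻¹ *
      (.of .a ^ n i)⁻¹)) = 1 := PresentedGroup.one_of_mem (Or.inr ⟨i, rfl⟩)
  simp only [map_mul, map_inv, map_pow] at h
  exact mul_inv_eq_one.1 h

theorem closure_gens (n : ι → ℕ) :
    Subgroup.closure (insert (a n) (Set.range (t n))) = ⊤ := by
  rw [eq_top_iff, ← PresentedGroup.closure_range_of (bsRels n)]
  refine Subgroup.closure_mono ?_
  rintro _ ⟨_ | i, rfl⟩
  · exact Set.mem_insert _ _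
  · exact Set.mem_insert_of_mem _ ⟨i, rfl⟩

/-- The subgroup generated by all the `t_i`. -/
def torus (n : ι → ℕ) : Subgroup (GammaS n) := Subgroup.closure (Set.range (t n))

theorem t_mem_torus (i : ι) : t n i ∈ torus n := Subgroup.subset_closure ⟨i, rfl⟩

theorem torus_commute {σ τ : GammaS n} (hσ : σ ∈ torus n) (hτ : τ ∈ torus n) :
    Commute σ τ := by
  induction hσ, hτ using Subgroup.closure_induction₂ with
  | mem x y hx hy =>
    obtain ⟨i, rfl⟩ := hx
    obtain ⟨j, rfl⟩ := hy
    exact t_commute i j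
  | one_left x _ => exact Commute.one_left x
  | one_right x _ => exact Commute.one_right x
  | mul_left x y z _ _ _ h₁ h₂ => exact h₁.mul_left h₂
  | mul_right y z x _ _ _ h₁ h₂ => exact h₁.mul_right h₂
  | inv_left x y _ _ h => exact h.inv_left
  | inv_right x y _ _ h => exact h.inv_right

theorem t_pow_conj_conj_a {τ : GammaS n} (hτ : τ ∈ torus n) (i : ι) (K : ℕ) :
    t n i ^ K * (τ * a n * τ⁻¹) * (t n i ^ K)⁻¹ = (τ * a n * τ⁻¹) ^ n i ^ K := by
  have key : ∀ σ ∈ torus n, t n i * (σ * a n * σ⁻¹) * (t n i)⁻¹ = (σ * a n * σ⁻¹) ^ n i := by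
    intro σ hσ
    have hc : t n i * σ = σ * t n i := torus_commute (t_mem_torus i) hσ
    rw [conj_pow, ← t_conj_a]
    calc t n i * (σ * a n * σ⁻¹) * (t n i)⁻¹ = (t n i * σ) * a n * (t n i * σ)⁻¹ := by group
      _ = (σ * t n i) * a n * (σ * t n i)⁻¹ := by rw [hc]
      _ = σ * (t n i * a n * (t n i)⁻¹) * σ⁻¹ := by group
  induction K with
  | zero => simp
  | succ K ih =>
    calc t n i ^ (K + 1) * (τ * a n * τ⁻¹) * (t n i ^ (K + 1))⁻¹
        = t n i * (t n i ^ K * (τ * a n * τ⁻¹) * (t n i ^ K)⁻¹) * (t n i)⁻¹ := by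
          rw [pow_succ']; group
      _ = (t n i * (τ * a n * τ⁻¹) * (t n i)⁻¹) ^ n i ^ K := by rw [ih]; exact conj_pow.symm
      _ = (τ * a n * τ⁻¹) ^ n i ^ (K + 1) := by rw [key τ hτ, ← pow_mul, pow_succ']

/-- The subgroup generated by the conjugates of `a` by elements of the torus. It is the normal
closure of `a`. -/
def base (n : ι → ℕ) : Subgroup (GammaS n) :=
  Subgroup.closure {x | ∃ τ ∈ torus n, x = τ * a n * τ⁻¹}

theorem torus_le_normalizer_base : torus n ≤ Subgroup.normalizer (base n : Set (GammaS n)) := by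
  have key : ∀ σ ∈ torus n, ∀ x ∈ base n, σ * x * σ⁻¹ ∈ base n := by
    intro σ hσ x hx
    induction hx using Subgroup.closure_induction with
    | mem x hx =>
      obtain ⟨τ, hτ, rfl⟩ := hx
      exact Subgroup.subset_closure ⟨σ * τ, mul_mem hσ hτ, by group⟩
    | one => simp
    | mul x y _ _ hx hy => simpa [mul_assoc] using mul_mem hx hy
    | inv x _ hx => simpa [mul_assoc] using inv_mem hx
  intro σ hσ
  refine Subgroup.mem_normalizer_iff.2 fun x => ⟨key σ hσ x, fun hx => ?_⟩
  simpa [mul_assoc] using key σ⁻¹ (inv_mem hσ) _ hx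

theorem exists_base_mul_torus (g : GammaS n) : ∃ k ∈ base n, ∃ τ ∈ torus n, k * τ = g := by
  have htop : base n ⊔ torus n = ⊤ := by
    rw [eq_top_iff, ← closure_gens, Subgroup.closure_le, Set.insert_subset_iff]
    refine ⟨?_, ?_⟩
    · exact Subgroup.mem_sup_left (Subgroup.subset_closure ⟨1, one_mem _, by simp⟩)
    · rintro _ ⟨i, rfl⟩
      exact Subgroup.mem_sup_right (t_mem_torus i)
  have hg : g ∈ ((base n ⊔ torus n : Subgroup (GammaS n)) : Set (GammaS n)) := by
    rw [htop]; trivial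
  rw [Subgroup.coe_mul_of_right_le_normalizer_left _ _ torus_le_normalizer_base] at hg
  exact Set.mem_mul.1 hg

/-- A real character kills `a`, which has finite order in the abelianization as some `n_i ≥ 2`. -/
theorem val_a (hn : ∃ i, 2 ≤ n i) (χ : RealChar (GammaS n)) : χ.val (a n) = 0 := by
  obtain ⟨i, hi⟩ := hn
  have h := congrArg χ.val (t_conj_a (n := n) i)
  rw [RealChar.val_conj, RealChar.val_pow] at h
  have h2 : (2 : ℝ) ≤ n i := by exact_mod_cast hi
  have h3 : ((n i : ℝ) - 1) * χ.val (a n) = 0 := by linarith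
  rcases mul_eq_zero.1 h3 with h4 | h4
  · linarith
  · exact h4

theorem realChar_ext (hn : ∃ i, 2 ≤ n i) {χ ψ : RealChar (GammaS n)}
    (h : ∀ i, χ.val (t n i) = ψ.val (t n i)) : χ = ψ := by
  refine RealChar.ext_of_closure (closure_gens n) ?_
  rintro g (rfl | ⟨i, rfl⟩)
  · rw [val_a hn, val_a hn]
  · exact h i

theorem chi_val_t_of_ne {i j : ι} (hij : j ≠ i) : (chi n i).val (t n j) = 0 := by
  simp [chi, RealChar.val, t, hij]

theorem chi_unique (hn : ∃ i, 2 ≤ n i) (i : ι) (ψ : RealChar (GammaS n)) :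
    (ψ.val (t n i) = 1 ∧ ∀ j, j ≠ i → ψ.val (t n j) = 0) ↔ ψ = chi n i := by
  constructor
  · rintro ⟨h1, h0⟩
    refine realChar_ext hn fun j => ?_
    by_cases hj : j = i
    · subst hj; rw [h1, chi_t_self]
    · rw [h0 j hj, chi_val_t_of_ne hj]
  · rintro rfl
    exact ⟨chi_t_self n i, fun j hj => chi_val_t_of_ne hj⟩

theorem chi_class_injective (n : ι → ℕ) :
    Function.Injective fun i => charClass (chi n i) (chi_ne_zero n i) := by
  intro i j hij
  obtain ⟨r, -, hr⟩ := (charClass_eq_iff _ _ _ _).1 hij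
  by_contra hne
  have h := congrArg (fun ψ => RealChar.val ψ (t n j)) hr
  simp only [RealChar.val_smul] at h
  rw [chi_val_t_of_ne (Ne.symm hne), chi_t_self] at h
  simp at h

/-! ### Characters in `Σ¹` -/

/-- Let `P` be a submonoid of the half space `χ ≥ 0`, closed under right division inside the half
space, that contains `a` and those of the `t_i^{±1}` in the half space. Unless `χ` is a positive
multiple of some `χ_i` with `n_i ≥ 2`, `P` is the whole half space: every torus conjugate `x`
of `a` lies in `P`, because conjugation by a suitable power of some `t_j^{±1}` brings `x` to a
member of `P`, which is a root or a power of `x`; in the case of powers, two coprime exponents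
(or the exponent `1`) occur. -/
theorem mem_of_half_space (hn : ∃ i, 2 ≤ n i) (hcop : ∀ i j, i ≠ j → Nat.Coprime (n i) (n j))
    {χ : RealChar (GammaS n)} {P : Submonoid (GammaS n)}
    (hdiv : ∀ g q, 0 ≤ χ.val g → q ∈ P → g * q ∈ P → g ∈ P)
    (ha : a n ∈ P) (ht : ∀ i, 0 ≤ χ.val (t n i) → t n i ∈ P)
    (htinv : ∀ i, χ.val (t n i) ≤ 0 → (t n i)⁻¹ ∈ P)
    (hχ : (∃ j, χ.val (t n j) < 0) ∨ (∃ i, 0 < χ.val (t n i) ∧ n i = 1) ∨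
      ∃ i j, i ≠ j ∧ 0 < χ.val (t n i) ∧ 0 < χ.val (t n j)) :
    ∀ g, 0 ≤ χ.val g → g ∈ P := by
  -- every torus element is a quotient of torus elements in `P`
  have hquot : ∀ τ ∈ torus n, ∃ p ∈ torus n, p ∈ P ∧ ∃ q ∈ torus n, q ∈ P ∧ τ * q = p := by
    intro τ hτ
    induction hτ using Subgroup.closure_induction with
    | mem x hx =>
      obtain ⟨i, rfl⟩ := hx
      rcases le_total 0 (χ.val (t n i)) with h | h
      · exact ⟨_, t_mem_torus i, ht i h, 1, one_mem _, one_mem _, mul_one _⟩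
      · exact ⟨1, one_mem _, one_mem _, _, inv_mem (t_mem_torus i), htinv i h, mul_inv_cancel _⟩
    | one => exact ⟨1, one_mem _, one_mem _, 1, one_mem _, one_mem _, mul_one _⟩
    | mul x y _ _ hx hy =>
      obtain ⟨p, hp, hpP, q, hq, hqP, rfl⟩ := hx
      obtain ⟨p', hp', hpP', q', hq', hqP', rfl⟩ := hy
      refine ⟨_, mul_mem hp hp', mul_mem hpP hpP', q' * q, mul_mem hq' hq, mul_mem hqP' hqP, ?_⟩
      rw [mul_assoc, mul_assoc x q, (torus_commute hq hp').eq, mul_assoc]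
    | inv x _ hx =>
      obtain ⟨p, hp, hpP, q, hq, hqP, rfl⟩ := hx
      exact ⟨q, hq, hqP, _, hp, hpP, by group⟩
  have htorus : ∀ τ ∈ torus n, 0 ≤ χ.val τ → τ ∈ P := by
    intro τ hτ h
    obtain ⟨p, -, hp, q, -, hq, rfl⟩ := hquot τ hτ
    exact hdiv τ q h hq hp
  -- the elements of height zero in `P` form a subgroup
  let H : Subgroup (GammaS n) :=
    { carrier := {g | g ∈ P ∧ χ.val g = 0}
      one_mem' := ⟨one_mem _, RealChar.val_one χ⟩
      mul_mem' := fun {g h} hg hh => ⟨mul_mem hg.1 hh.1, by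
        rw [RealChar.val_mul, hg.2, hh.2, add_zero]⟩
      inv_mem' := fun {g} hg => by
        have h0 : χ.val g⁻¹ = 0 := by rw [RealChar.val_inv, hg.2, neg_zero]
        refine ⟨hdiv _ g h0.ge hg.1 ?_, h0⟩
        rw [inv_mul_cancel]; exact one_mem _ }
  have hx0 : ∀ τ, χ.val (τ * a n * τ⁻¹) = 0 := fun τ => by rw [RealChar.val_conj, val_a hn]
  have hconj : ∀ τ ∈ torus n, 0 ≤ χ.val τ → τ * a n * τ⁻¹ ∈ H := by
    intro τ hτ h
    refine ⟨hdiv _ τ (hx0 τ).ge (htorus τ hτ h) ?_, hx0 τ⟩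
    rw [inv_mul_cancel_right]
    exact mul_mem (htorus τ hτ h) ha
  have hpow : ∀ i, 0 < χ.val (t n i) → ∀ τ ∈ torus n, ∃ K : ℕ, (τ * a n * τ⁻¹) ^ n i ^ K ∈ H := by
    intro i hi τ hτ
    obtain ⟨K, hK⟩ := exists_nat_ge (-χ.val τ / χ.val (t n i))
    rw [div_le_iff₀ hi] at hK
    refine ⟨K, ?_⟩
    rw [← t_pow_conj_conj_a hτ]
    have h := hconj (t n i ^ K * τ) (mul_mem (pow_mem (t_mem_torus i) K) hτ)
      (by rw [RealChar.val_mul, RealChar.val_pow]; linarith)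
    convert h using 1
    group
  have hbase : base n ≤ H := by
    rw [base, Subgroup.closure_le]
    rintro _ ⟨τ, hτ, rfl⟩
    rw [SetLike.mem_coe]
    rcases hχ with ⟨j, hj⟩ | ⟨i, hi, hi1⟩ | ⟨i, j, hij, hi, hj⟩
    · -- conjugation by `t_j^{-K}` takes a root of `τ a τ⁻¹`, and it leads into `H`
      obtain ⟨K, hK⟩ := exists_nat_ge (-χ.val τ / -χ.val (t n j))
      rw [div_le_iff₀ (by linarith)] at hK
      have hσ : (t n j ^ K)⁻¹ * τ ∈ torus n :=
        mul_mem (inv_mem (pow_mem (t_mem_torus j) K)) hτ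
      have h := hconj _ hσ
        (by rw [RealChar.val_mul, RealChar.val_inv, RealChar.val_pow]; linarith)
      have h' := pow_mem h (n j ^ K)
      rw [← t_pow_conj_conj_a hσ] at h'
      convert h' using 1
      group
    · obtain ⟨K, hK⟩ := hpow i hi τ hτ
      simpa [hi1] using hK
    · obtain ⟨K, hK⟩ := hpow i hi τ hτ
      obtain ⟨M, hM⟩ := hpow j hj τ hτ
      have hgcd := Nat.gcd_eq_gcd_ab (n i ^ K) (n j ^ M)
      rw [Nat.Coprime.gcd_eq_one ((hcop i j hij).pow K M)] at hgcd
      have h := mul_mem (zpow_mem hK (Nat.gcdA (n i ^ K) (n j ^ M)))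
        (zpow_mem hM (Nat.gcdB (n i ^ K) (n j ^ M)))
      rw [← zpow_natCast, ← zpow_natCast, ← zpow_mul, ← zpow_mul, ← zpow_add, ← hgcd] at h
      simpa using h
  intro g hg
  obtain ⟨k, hk, τ, hτ, rfl⟩ := exists_base_mul_torus g
  rw [RealChar.val_mul, (hbase hk).2, zero_add] at hg
  exact mul_mem (hbase hk).1 (htorus τ hτ hg)

theorem cayleyHalf_connected [Finite ι] (hn : ∃ i, 2 ≤ n i)
    (hcop : ∀ i j, i ≠ j → Nat.Coprime (n i) (n j)) {X : Set (GammaS n)}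
    (hX : Subgroup.closure X = ⊤) {χ : RealChar (GammaS n)} (h0 : χ ≠ 0)
    (hχ : (∃ j, χ.val (t n j) < 0) ∨ (∃ i, 0 < χ.val (t n i) ∧ n i = 1) ∨
      ∃ i j, i ≠ j ∧ 0 < χ.val (t n i) ∧ 0 < χ.val (t n j)) :
    (cayleyHalf X χ).Connected := by
  obtain ⟨d, hd⟩ := HalfReach.exists_forall_of_finite hX χ
    (((Set.finite_range (t n)).union (Set.finite_range fun i => (t n i)⁻¹)).insert (a n))
  refine cayleyHalf_connected_of_bounded_depth hX h0 (d := d) fun g hg => ?_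
  refine (mem_of_half_space (P := reachSubmonoid X χ d) hn hcop
    (fun g q => reachSubmonoid_of_mul_mem) ⟨(val_a hn χ).ge, hd _ (Set.mem_insert _ _)⟩
    (fun i hi => ⟨hi, hd _ (Or.inr (Or.inl ⟨i, rfl⟩))⟩)
    (fun i hi => ⟨?_, hd _ (Or.inr (Or.inr ⟨i, rfl⟩))⟩) hχ g hg).2
  rw [RealChar.val_inv]; linarith

/-- The only characters left are the positive multiples of those `χ_i` with `n_i ≥ 2`. -/
theorem eq_smul_chi_or_connected [Finite ι] (hpos : ∀ i, 0 < n i) (hn : ∃ i, 2 ≤ n i)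
    (hcop : ∀ i j, i ≠ j → Nat.Coprime (n i) (n j)) {X : Set (GammaS n)}
    (hX : Subgroup.closure X = ⊤) {χ : RealChar (GammaS n)} (h0 : χ ≠ 0) :
    (cayleyHalf X χ).Connected ∨ ∃ i, 2 ≤ n i ∧ ∃ r : ℝ, 0 < r ∧ r • chi n i = χ := by
  refine or_iff_not_imp_left.2 fun hcon => ?_
  have h := fun hχ => hcon (cayleyHalf_connected hn hcop hX h0 hχ)
  simp only [imp_false, not_or, not_exists, not_and, not_lt] at h
  obtain ⟨hnonneg, hone, htwo⟩ := h
  obtain ⟨i, hi⟩ : ∃ i, 0 < χ.val (t n i) := by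
    by_contra! hle
    exact h0 (realChar_ext hn fun i => le_antisymm (hle i) (hnonneg i))
  refine ⟨i, ?_, χ.val (t n i), hi, realChar_ext hn fun j => ?_⟩
  · have := hpos i
    have := hone i hi
    omega
  · rw [RealChar.val_smul]
    by_cases hj : j = i
    · rw [hj, chi_t_self, mul_one]
    · rw [chi_val_t_of_ne hj, mul_zero]
      exact le_antisymm (hnonneg j) (htwo i j (Ne.symm hj) hi)

/-! ### Characters outside `Σ¹` -/

/-- The action of `Γ(S)` on `ℚ_p` by affine maps: `a` acts as `x ↦ x + 1` and `t_i` as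
`x ↦ n_i x`. -/
def padicAction (hpos : ∀ i, 0 < n i) (p : ℕ) [Fact p.Prime] :
    GammaS n →* Equiv.Perm ℚ_[p] :=
  PresentedGroup.toGroup (rels := bsRels n)
    (f := fun g : BSGen ι => match g with
      | .a => Equiv.addRight 1
      | .t i => Equiv.mulLeft₀ (n i : ℚ_[p]) (Nat.cast_ne_zero.2 (hpos i).ne'))
    (by
      rintro w (⟨i, j, -, rfl⟩ | ⟨i, rfl⟩)
      · simp only [map_mul, map_inv, FreeGroup.lift_apply_of]
        rw [mul_inv_eq_one, mul_inv_eq_iff_eq_mul]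
        ext x
        simp [mul_left_comm]
      · simp only [map_mul, map_inv, map_pow, FreeGroup.lift_apply_of]
        rw [mul_inv_eq_one, mul_inv_eq_iff_eq_mul]
        ext x
        simp [mul_add])

section

variable (hpos : ∀ i, 0 < n i) (p : ℕ) [Fact p.Prime]

theorem padicAction_a (x : ℚ_[p]) : padicAction hpos p (a n) x = x + 1 := by
  simp [padicAction, a]

theorem padicAction_t (i : ι) (x : ℚ_[p]) : padicAction hpos p (t n i) x = n i * x := by
  simp [padicAction, t]

theorem padicAction_t_pow (i : ι) (m : ℕ) (x : ℚ_[p]) :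
    padicAction hpos p (t n i ^ m) x = (n i : ℚ_[p]) ^ m * x := by
  induction m with
  | zero => simp
  | succ m ih =>
    rw [pow_succ', map_mul, Equiv.Perm.mul_apply, ih, padicAction_t, pow_succ', mul_assoc]

/-- If `p` divides `n_i`, then `g` scales `p`-adic distances by `|n_i|_p ^ χ_i(g)`, because the
other `n_j` are `p`-adic units. -/
theorem dist_padicAction (hcop : ∀ i j, i ≠ j → Nat.Coprime (n i) (n j)) {i : ι} (hp : p ∣ n i)
    (g : GammaS n) (x y : ℚ_[p]) :
    dist (padicAction hpos p g x) (padicAction hpos p g y) =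
      ‖(n i : ℚ_[p])‖ ^ (chi n i).val g * dist x y := by
  have hc : 0 < ‖(n i : ℚ_[p])‖ := norm_pos_iff.2 (Nat.cast_ne_zero.2 (hpos i).ne')
  have hg : g ∈ Subgroup.closure (insert (a n) (Set.range (t n))) :=
    closure_gens n ▸ Subgroup.mem_top g
  induction hg using Subgroup.closure_induction generalizing x y with
  | mem g hg =>
    rcases hg with rfl | ⟨j, rfl⟩
    · have h0 : (chi n i).val (a n) = 0 := by simp [chi, RealChar.val, a]
      rw [h0, padicAction_a, padicAction_a, Real.rpow_zero, one_mul, dist_add_right]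
    · rw [padicAction_t, padicAction_t, dist_eq_norm, ← mul_sub, norm_mul, ← dist_eq_norm]
      by_cases hj : j = i
      · rw [hj, chi_t_self, Real.rpow_one]
      · rw [chi_val_t_of_ne hj, Real.rpow_zero, Padic.norm_natCast_eq_one_iff.2]
        exact (hcop i j (Ne.symm hj)).coprime_dvd_left hp
  | one => simp [RealChar.val_one]
  | mul g h _ _ hg hh =>
    rw [map_mul, Equiv.Perm.mul_apply, Equiv.Perm.mul_apply, hg, hh, RealChar.val_mul,
      Real.rpow_add hc, mul_assoc]
  | inv g _ hg =>
    have h := hg (padicAction hpos p g⁻¹ x) (padicAction hpos p g⁻¹ y)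
    rw [← Equiv.Perm.mul_apply, ← Equiv.Perm.mul_apply, ← map_mul, mul_inv_cancel, map_one,
      Equiv.Perm.one_apply, Equiv.Perm.one_apply] at h
    rw [h, RealChar.val_inv, ← mul_assoc, ← Real.rpow_add hc, neg_add_cancel, Real.rpow_zero,
      one_mul]

end

/-- Along a path in the half space `χ_i ≥ 0`, the orbit point `g • 0` stays in a ball of `ℚ_p`,
by the ultrametric inequality; but the elements `t_i^{-m} a t_i^m` of height `0` move `0` to
`n_i^{-m}`, which is unbounded. -/
theorem not_cayleyHalf_connected (hpos : ∀ i, 0 < n i)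
    (hcop : ∀ i j, i ≠ j → Nat.Coprime (n i) (n j)) {i : ι} (hi : 2 ≤ n i)
    {X : Set (GammaS n)} (hX : X.Finite) {r : ℝ} (hr : 0 < r) :
    ¬ (cayleyHalf X (r • chi n i)).Connected := by
  intro hconn
  obtain ⟨p, hprime, hp⟩ := Nat.exists_prime_and_dvd (by omega : n i ≠ 1)
  have : Fact p.Prime := ⟨hprime⟩
  set c := ‖(n i : ℚ_[p])‖ with hc_def
  have hc : 0 < c := norm_pos_iff.2 (Nat.cast_ne_zero.2 (hpos i).ne')
  have hc1 : c < 1 := Padic.norm_natCast_lt_one_iff.2 hp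
  set ρ := padicAction hpos p with hρ
  obtain ⟨C, hC⟩ := (hX.image fun x => ‖ρ x 0‖).bddAbove
  -- an edge of the half space moves the orbit point by at most `C`
  have hedge : ∀ g x, x ∈ X → 0 ≤ (r • chi n i).val g → dist (ρ (g * x) 0) (ρ g 0) ≤ C := by
    intro g x hx hg
    rw [RealChar.val_smul] at hg
    have hg' : 0 ≤ (chi n i).val g := nonneg_of_mul_nonneg_right hg hr
    rw [map_mul, Equiv.Perm.mul_apply, dist_padicAction hpos p hcop hp, dist_zero_right]
    calc c ^ (chi n i).val g * ‖ρ x 0‖ ≤ 1 * ‖ρ x 0‖ := by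
          gcongr
          exact Real.rpow_le_one hc.le hc1.le hg'
      _ ≤ C := by rw [one_mul]; exact hC ⟨x, hx, rfl⟩
  have hbound : ∀ g : {g | 0 ≤ (r • chi n i).val g}, ‖ρ g 0‖ ≤ max C 0 := by
    intro g
    have h1 : 0 ≤ (r • chi n i).val 1 := (RealChar.val_one _).ge
    have hreach := hconn.preconnected ⟨1, h1⟩ g
    rw [SimpleGraph.reachable_iff_reflTransGen] at hreach
    induction hreach with
    | refl => simp
    | @tail u v _ huv ih =>
      rw [cayleyHalf, SimpleGraph.induce, SimpleGraph.comap_adj] at huv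
      obtain ⟨-, x, hx, h⟩ := (SimpleGraph.mulCayley_adj' X _ _).1 huv
      have hd : dist (ρ v 0) (ρ u 0) ≤ C := by
        rcases h with h | h
        · rw [← show _ = (v : GammaS n) from h]; exact hedge _ x hx u.2
        · rw [show (u : GammaS n) = _ from h, dist_comm]; exact hedge _ x hx v.2
      calc ‖ρ v 0‖ = dist (ρ v 0) 0 := (dist_zero_right _).symm
        _ ≤ max (dist (ρ v 0) (ρ u 0)) (dist (ρ u 0) 0) := dist_triangle_max _ _ _
        _ ≤ max C 0 := by
          rw [dist_zero_right]
          exact max_le (hd.trans (le_max_left _ _)) ih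
  obtain ⟨m, hm⟩ := pow_unbounded_of_one_lt (max C 0) ((one_lt_inv₀ hc).2 hc1)
  have hg0 : (r • chi n i).val ((t n i ^ m)⁻¹ * a n * t n i ^ m) = 0 := by
    have h := RealChar.val_conj (r • chi n i) (t n i ^ m)⁻¹ (a n)
    rw [inv_inv] at h
    rw [h, val_a ⟨i, hi⟩]
  have hb := hbound ⟨_, hg0.ge⟩
  have hval : ρ ((t n i ^ m)⁻¹ * a n * t n i ^ m) 0 = ((n i : ℚ_[p])⁻¹) ^ m := by
    have h : ρ (t n i ^ m) (ρ ((t n i ^ m)⁻¹ * a n * t n i ^ m) 0) = 1 := by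
      rw [← Equiv.Perm.mul_apply, ← map_mul, mul_assoc, mul_inv_cancel_left, map_mul,
        Equiv.Perm.mul_apply, padicAction_t_pow, padicAction_a, mul_zero, zero_add]
    rw [padicAction_t_pow] at h
    rw [inv_pow]
    exact eq_inv_of_mul_eq_one_right h
  rw [hval, norm_pow, norm_inv] at hb
  exact absurd hb (not_le.2 hm)

end GammaS

/-! ### The abelianization and hemispheres -/

/-- The image of `g` in the abelianization of `G` modulo torsion. -/
def toFreeAb {G : Type*} [Group G] :
    Additive G →+ Additive (Abelianization G) ⧸ Submodule.torsion ℤ (Additive (Abelianization G)) :=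
  (Submodule.mkQ _).toAddMonoidHom.comp (MonoidHom.toAdditive Abelianization.of)

/-- The linear form induced by a real character on the abelianization modulo torsion. -/
def RealChar.liftFreeAb {G : Type*} [Group G] (χ : RealChar G) :
    (Additive (Abelianization G) ⧸ Submodule.torsion ℤ (Additive (Abelianization G))) →ₗ[ℤ] ℝ :=
  (Submodule.torsion ℤ (Additive (Abelianization G))).liftQ
    (MonoidHom.toAdditiveLeft
      (Abelianization.lift (AddMonoidHom.toMultiplicativeRight χ))).toIntLinearMap
    (by
      rintro x ⟨⟨c, hc⟩, hx⟩
      rw [Submonoid.mk_smul] at hx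
      have h := congrArg (MonoidHom.toAdditiveLeft
        (Abelianization.lift (AddMonoidHom.toMultiplicativeRight χ))).toIntLinearMap hx
      rw [map_smul, map_zero, smul_eq_zero] at h
      exact h.resolve_left (nonZeroDivisors.ne_zero hc))

theorem RealChar.liftFreeAb_apply {G : Type*} [Group G] (χ : RealChar G) (g : G) :
    χ.liftFreeAb (toFreeAb (Additive.ofMul g)) = χ.val g := rfl

namespace GammaS

variable {ι : Type*} {n : ι → ℕ}

theorem toFreeAb_a (hn : ∃ i, 2 ≤ n i) :
    toFreeAb (Additive.ofMul (a n)) = 0 := by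
  obtain ⟨i, hi⟩ := hn
  refine (Submodule.Quotient.mk_eq_zero _).2 ?_
  have h := congrArg (fun g => Additive.ofMul (Abelianization.of g)) (t_conj_a (n := n) i)
  simp only [map_mul, map_inv, map_pow, ofMul_mul, ofMul_inv, ofMul_pow] at h
  have h' : ((n i : ℤ) - 1) • Additive.ofMul (Abelianization.of (a n)) = 0 := by
    rw [sub_smul, natCast_zsmul, ← h, one_smul]
    abel
  exact ⟨⟨(n i : ℤ) - 1, mem_nonZeroDivisors_of_ne_zero (by omega)⟩, h'⟩

/-- The `t_i`, in any order, are free-abelian generators of `Γ(S)`: the `χ_i` show that their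
images are independent. -/
theorem isFreeAbGenerators (hn : ∃ i, 2 ≤ n i) {k : ℕ} (e : Fin k ≃ ι) :
    IsFreeAbGenerators fun l => t n (e l) := by
  have hli : LinearIndependent ℤ fun l => toFreeAb (Additive.ofMul (t n (e l))) := by
    rw [Fintype.linearIndependent_iff]
    intro c hc l
    have h := congrArg (chi n (e l)).liftFreeAb hc
    rw [map_sum, map_zero, Finset.sum_eq_single l] at h
    · rw [map_smul, RealChar.liftFreeAb_apply, chi_t_self] at h
      simpa using h
    · intro m _ hm
      rw [map_smul, RealChar.liftFreeAb_apply, chi_val_t_of_ne (e.injective.ne hm), smul_zero]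
    · simp
  have hspan : ⊤ ≤ Submodule.span ℤ
      (Set.range fun l => toFreeAb (Additive.ofMul (t n (e l)))) := by
    have key : ∀ g : GammaS n, toFreeAb (Additive.ofMul g) ∈ Submodule.span ℤ
        (Set.range fun l => toFreeAb (Additive.ofMul (t n (e l)))) := by
      intro g
      have hg : g ∈ Subgroup.closure (insert (a n) (Set.range (t n))) :=
        closure_gens n ▸ Subgroup.mem_top g
      induction hg using Subgroup.closure_induction with
      | mem g hg =>
        rcases hg with rfl | ⟨i, rfl⟩
        · rw [toFreeAb_a hn]; exact zero_mem _
        · exact Submodule.subset_span ⟨e.symm i, by simp⟩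
      | one => rw [ofMul_one, map_zero]; exact zero_mem _
      | mul g h _ _ hg hh => rw [ofMul_mul, map_add]; exact add_mem hg hh
      | inv g _ hg => rw [ofMul_inv, map_neg]; exact neg_mem hg
    rintro q -
    obtain ⟨x, rfl⟩ := Submodule.Quotient.mk_surjective _ q
    obtain ⟨g, rfl⟩ : ∃ g : GammaS n, Additive.ofMul (Abelianization.of g) = x :=
      QuotientGroup.mk_surjective x.toMul
    exact key g
  exact ⟨Module.Basis.mk hli hspan, fun l => Module.Basis.mk_apply hli hspan l⟩

/-- All the `[χ_i]` lie in the hemisphere about the vector `(1, …, 1)`. -/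
theorem exists_hemisphere [Finite ι] (hn : ∃ i, 2 ≤ n i) :
    ∃ U : Set (CharSphere (GammaS n)), IsOpenHemisphere U ∧
      ∀ i, charClass (chi n i) (chi_ne_zero n i) ∈ U := by
  obtain ⟨k, ⟨e⟩⟩ := Finite.exists_equiv_fin ι
  set w : EuclideanSpace ℝ (Fin k) := WithLp.toLp 2 fun _ => 1 with hw
  have hinner : ∀ i, inner ℝ (charVector (fun l => t n (e.symm l)) (chi n i)) w = 1 := by
    intro i
    rw [PiLp.inner_apply, Finset.sum_eq_single (e i)]
    · simp [charVector, hw, chi_t_self]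
    · intro l _ hl
      have hl' : e.symm l ≠ i := fun h => hl (by rw [← h, e.apply_symm_apply])
      simp [charVector, hw, chi_val_t_of_ne hl']
    · simp
  have hw0 : w ≠ 0 := by
    obtain ⟨i, -⟩ := hn
    intro h
    have := hinner i
    rw [h, inner_zero_right] at this
    exact zero_ne_one this
  refine ⟨_, ⟨k, _, ‖w‖⁻¹ • w, isFreeAbGenerators hn e.symm, norm_smul_inv_norm hw0, rfl⟩,
    fun i => ?_⟩
  have hv0 : charVector (fun l => t n (e.symm l)) (chi n i) ≠ 0 := by
    intro h
    have := hinner i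
    rw [h, inner_zero_left] at this
    exact zero_ne_one this
  change 0 < inner ℝ (‖charVector (fun l => t n (e.symm l)) (chi n i)‖⁻¹ •
    charVector (fun l => t n (e.symm l)) (chi n i)) (‖w‖⁻¹ • w)
  rw [real_inner_smul_left, real_inner_smul_right, hinner, mul_one]
  exact mul_pos (inv_pos.2 (norm_pos_iff.2 hv0)) (inv_pos.2 (norm_pos_iff.2 hw0))

/-! ### The invariant -/

theorem compl_Sigma1 [Finite ι] (hpos : ∀ i, 0 < n i)
    (hcop : ∀ i j, i ≠ j → Nat.Coprime (n i) (n j)) (hn : ∃ i, 2 ≤ n i) {X : Set (GammaS n)}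
    (hXfin : X.Finite) (hX : Subgroup.closure X = ⊤) :
    (Sigma1 X)ᶜ = {s | ∃ i, 2 ≤ n i ∧ s = charClass (chi n i) (chi_ne_zero n i)} := by
  ext s
  constructor
  · intro hs
    induction s using Module.Ray.ind with
    | h χ h0 =>
    rcases eq_smul_chi_or_connected hpos hn hcop hX h0 with h | ⟨i, hi, hr⟩
    · exact absurd ⟨χ, h0, rfl, h⟩ hs
    · exact ⟨i, hi, ((charClass_eq_iff _ _ (chi_ne_zero n i) h0).2 hr).symm⟩
  · rintro ⟨i, hi, rfl⟩ ⟨χ, h0, hs, hconn⟩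
    obtain ⟨r, hr, rfl⟩ := (charClass_eq_iff _ _ _ _).1 hs
    exact not_cayleyHalf_connected hpos hcop hi hXfin hr hconn

theorem compl_Sigma1_of_two_le [Finite ι] (hpos : ∀ i, 0 < n i)
    (hcop : ∀ i j, i ≠ j → Nat.Coprime (n i) (n j)) (hn : ∃ i, 2 ≤ n i) {X : Set (GammaS n)}
    (hXfin : X.Finite) (hX : Subgroup.closure X = ⊤) (h2 : ∀ i, 2 ≤ n i) :
    (Sigma1 X)ᶜ = Set.range fun i => charClass (chi n i) (chi_ne_zero n i) := by
  rw [compl_Sigma1 hpos hcop hn hXfin hX]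
  ext s
  exact ⟨fun ⟨i, _, hs⟩ => ⟨i, hs.symm⟩, fun ⟨i, hs⟩ => ⟨i, h2 i, hs.symm⟩⟩

theorem compl_Sigma1_subset_hemisphere [Finite ι] (hpos : ∀ i, 0 < n i)
    (hcop : ∀ i j, i ≠ j → Nat.Coprime (n i) (n j)) (hn : ∃ i, 2 ≤ n i) {X : Set (GammaS n)}
    (hXfin : X.Finite) (hX : Subgroup.closure X = ⊤) :
    ∃ U : Set (CharSphere (GammaS n)), IsOpenHemisphere U ∧ (Sigma1 X)ᶜ ⊆ U := by
  obtain ⟨U, hU, hmem⟩ := exists_hemisphere hn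
  refine ⟨U, hU, ?_⟩
  rw [compl_Sigma1 hpos hcop hn hXfin hX]
  rintro _ ⟨i, -, rfl⟩
  exact hmem i

end GammaS

/-! ### Prime powers -/

theorem two_le_primePowers {N : ℕ} (p : N.primeFactors) : 2 ≤ primePowers N p := by
  have hp := Nat.prime_of_mem_primeFactors p.2
  calc 2 ≤ (p : ℕ) := hp.two_le
    _ ≤ primePowers N p := Nat.le_self_pow
      (hp.factorization_pos_of_dvd (Nat.mem_primeFactors.1 p.2).2.2
        (Nat.dvd_of_mem_primeFactors p.2)).ne' _

theorem coprime_primePowers {N : ℕ} (p q : N.primeFactors) (hpq : p ≠ q) :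
    Nat.Coprime (primePowers N p) (primePowers N q) :=
  Nat.Coprime.pow _ _ ((Nat.coprime_primes (Nat.prime_of_mem_primeFactors p.2)
    (Nat.prime_of_mem_primeFactors q.2)).2 fun h => hpq (Subtype.ext h))

end

theorem theorem2 :
    -- the groups `Γ(S)`
    (∀ (ι : Type) [Finite ι] (n : ι → ℕ),
      (∀ i, 0 < n i) → (∀ i j, i ≠ j → Nat.Coprime (n i) (n j)) → (∃ i, 2 ≤ n i) →
      -- `χ_i` is the unique character with `χ_i(t_i) = 1` and `χ_i(t_j) = 0` for `j ≠ i`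
      (∀ (i : ι) (ψ : RealChar (GammaS n)),
        (ψ.val (GammaS.t n i) = 1 ∧ ∀ j, j ≠ i → ψ.val (GammaS.t n j) = 0) ↔ ψ = chi n i) ∧
      -- the classes `[χ_i]` are pairwise distinct
      (Function.Injective fun i => charClass (chi n i) (chi_ne_zero n i)) ∧
      ∀ X : Set (GammaS n), X.Finite → Subgroup.closure X = ⊤ →
        (Sigma1 X)ᶜ = {s | ∃ i, 2 ≤ n i ∧ s = charClass (chi n i) (chi_ne_zero n i)} ∧
        ((∀ i, 2 ≤ n i) →
          (Sigma1 X)ᶜ = Set.range fun i => charClass (chi n i) (chi_ne_zero n i)) ∧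
        ∃ U : Set (CharSphere (GammaS n)), IsOpenHemisphere U ∧ (Sigma1 X)ᶜ ⊆ U) ∧
    -- the groups `Γ_N`
    (∀ N : ℕ, 2 ≤ N → ∀ X : Set (GammaN N), X.Finite → Subgroup.closure X = ⊤ →
      (Sigma1 X)ᶜ =
        (Set.range fun p => charClass (chi (primePowers N) p) (chi_ne_zero (primePowers N) p)) ∧
      ∃ U : Set (CharSphere (GammaN N)), IsOpenHemisphere U ∧ (Sigma1 X)ᶜ ⊆ U) := by
  refine ⟨fun ι _ n hpos hcop hn => ⟨GammaS.chi_unique hn, GammaS.chi_class_injective n,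
    fun X hXfin hX => ⟨GammaS.compl_Sigma1 hpos hcop hn hXfin hX,
      GammaS.compl_Sigma1_of_two_le hpos hcop hn hXfin hX,
      GammaS.compl_Sigma1_subset_hemisphere hpos hcop hn hXfin hX⟩⟩, fun N hN X hXfin hX => ?_⟩
  have hpos : ∀ p, 0 < primePowers N p := fun p =>
    lt_of_lt_of_le two_pos (two_le_primePowers p)
  obtain ⟨p, hp⟩ := Nat.nonempty_primeFactors.2 hN
  have hex : ∃ p, 2 ≤ primePowers N p := ⟨⟨p, hp⟩, two_le_primePowers _⟩
  exact ⟨GammaS.compl_Sigma1_of_two_le hpos coprime_primePowers hex hXfin hX two_le_primePowers,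
    GammaS.compl_Sigma1_subset_hemisphere hpos coprime_primePowers hex hXfin hX⟩
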